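/- Let $(X,\sigma)$ be a real vector space with a non-degenerate symplectic (alternating bilinear) form, of arbitrary dimension. Let $\mathcal W=\mathcal W(X,\sigma)$ be its Weyl algebra, i.e. a nonzero unital C*-algebra generated as a C*-algebra by unitaries $W(f)$, $f\in X$, satisfying $W(f)^*=W(-f)$ and $W(f)W(g)=e^{-\frac i2\sigma(f,g)}W(f+g)$ for all $f,g\in X$, and let $\mathcal W_0=\mathcal W_0(X,\sigma)\subset\mathcal W$ be the *-algebra generated by the Weyl elements $W(f)$. Then the following hold. 1. $\mathcal W_0$ is algebraically amenable: there is a net $(V_\lambda)$ of nonzero finite-dimensional subspaces of $\mathcal W_0$ with $\lim_\lambda \dim(AV_\lambda+V_\lambda)/\dim V_\lambda=1$ for every $A\in\mathcal W_0$. 2. The subspaces can be taken to be spans of Weyl elements over boxes. For $g=(g_1,\dots,g_n)\in X^n$ and $N\ge 1$ put $V_{g,N}=\mathrm{span}\{W(k_1g_1+\dots+k_ng_n)\mid k_1,\dots,k_n\in\{1,\dots,N\}\}$. Then $V_{g,N}$ is a nonzero finite-dimensional subspace of $\mathcal W_0$ and $\dim(W(g_i)V_{g,N}+V_{g,N})\le(1+\tfrac1N)\dim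 V_{g,N}$ for $i=1,\dots,n$. Moreover, for every finite $\mathcal F\subset\mathcal W_0$ and every $\varepsilon>0$ there are $n$, $g\in X^n$ and $N_0$ such that $\dim(AV_{g,N}+V_{g,N})\le(1+\varepsilon)\dim V_{g,N}$ for all $A\in\mathcal F$ and all $N\ge\max(N_0,1)$. 3. $\mathcal W$ is a Følner C*-algebra: there is a net of contractive completely positive maps $\varphi_\lambda\colon\mathcal W\to M_{k(\lambda)}(\mathbb C)$, $k(\lambda)\ge1$, with $\lim_\lambda\|\varphi_\lambda(AB)-\varphi_\lambda(A)\varphi_\lambda(B)\|_{2,\mathrm{tr}}=0$ and $\lim_\lambda\|\varphi_\lambda(A)\|=\|A\|$ for all $A,B\in\mathcal W$, where $\|F\|_{2,\mathrm{tr}}=\sqrt{\mathrm{tr}(F^*F)}$ and $\mathrm{tr}$ is the normalized trace. -/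

import Mathlib

open Filter Topology
open scoped CStarAlgebra ComplexOrder lp

universe u v

noncomputable section

/-- `a V + V` for an element `a` and a subspace `V` of an algebra. -/
def mulAddSubspace {A : Type v} [Ring A] [Algebra ℂ A] (a : A) (V : Submodule ℂ A) :
    Submodule ℂ A :=
  V.map (LinearMap.mulLeft ℂ a) ⊔ V

/-- Algebraic amenability of a `*`-subalgebra `S` of a C⋆-algebra: there is a net of nonzero
finite-dimensional subspaces `V i` of `S` such that `dim (a V i + V i) / dim (V i) → 1` for every
`a ∈ S`. A net is a family indexed by a nonempty directed preorder. -/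
def IsAlgebraicallyAmenable {A : Type v} [CStarAlgebra A] (S : StarSubalgebra ℂ A) : Prop :=
  ∃ (ι : Type v) (_ : Preorder ι) (_ : IsDirectedOrder ι) (_ : Nonempty ι)
    (V : ι → Submodule ℂ A),
    (∀ i, V i ≤ S.toSubalgebra.toSubmodule ∧ V i ≠ ⊥ ∧ FiniteDimensional ℂ (V i)) ∧
    ∀ a ∈ S, Tendsto
      (fun i => (Module.finrank ℂ (mulAddSubspace a (V i)) : ℝ) / Module.finrank ℂ (V i))
      atTop (𝓝 1)

/-- The norm `‖F‖_{2,tr} = √ tr(F⋆ F)` on `k × k` matrices, where `tr` is the normalized trace. -/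
def traceNorm₂ {k : ℕ} (F : CStarMatrix (Fin k) (Fin k) ℂ) : ℝ :=
  Real.sqrt ((∑ i, (star F * F) i i).re / k)

/-- Følner C⋆-algebras: there is a net of contractive completely positive maps
`φ i : A → M_{k i}(ℂ)`, `k i ≥ 1`, which is asymptotically multiplicative in `‖·‖_{2,tr}` and
asymptotically isometric for the C⋆-norms. -/
def IsFolnerCStarAlgebra (A : Type v) [NonUnitalCStarAlgebra A] [PartialOrder A]
    [StarOrderedRing A] : Prop :=
  ∃ (ι : Type v) (_ : Preorder ι) (_ : IsDirectedOrder ι) (_ : Nonempty ι)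
    (k : ι → ℕ) (φ : ∀ i, A →CP CStarMatrix (Fin (k i)) (Fin (k i)) ℂ),
    (∀ i, 0 < k i) ∧
    (∀ i a, ‖φ i a‖ ≤ ‖a‖) ∧
    (∀ a b, Tendsto (fun i => traceNorm₂ (φ i (a * b) - φ i a * φ i b)) atTop (𝓝 0)) ∧
    ∀ a, Tendsto (fun i => ‖φ i a‖) atTop (𝓝 ‖a‖)

/-- `W₀(X, σ)`: the `*`-algebra generated by the Weyl elements. -/
def weylStarAlgebra {X : Type u} {A : Type v} [CStarAlgebra A] (W : X → A) :
    StarSubalgebra ℂ A :=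
  StarAlgebra.adjoin ℂ (Set.range W)

/-- The C⋆-algebra `A` together with `W : X → A` is the Weyl algebra of `(X, σ)`: `A` is nonzero,
the `W f` are unitaries satisfying the canonical commutation relations, and they generate `A` as
a C⋆-algebra. -/
structure IsWeylAlgebra {X : Type u} [AddCommGroup X] [Module ℝ X]
    (σ : LinearMap.BilinForm ℝ X) {A : Type v} [CStarAlgebra A] (W : X → A) : Prop where
  nontrivial : Nontrivial A
  unitary : ∀ f, W f ∈ unitary A
  star_eq : ∀ f, star (W f) = W (-f)
  mul_eq : ∀ f g, W f * W g = Complex.exp (-(Complex.I / 2) * (σ f g : ℂ)) • W (f + g)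
  generates : (weylStarAlgebra W).topologicalClosure = ⊤

/-- The span of the Weyl elements `W (k₁ g₁ + ⋯ + kₙ gₙ)` with `1 ≤ kᵢ ≤ N`. -/
def weylBoxSubspace {X : Type u} [AddCommGroup X] {A : Type v} [CStarAlgebra A] (W : X → A)
    {n : ℕ} (g : Fin n → X) (N : ℕ) : Submodule ℂ A :=
  Submodule.span ℂ {a | ∃ k : Fin n → ℕ, (∀ i, 1 ≤ k i ∧ k i ≤ N) ∧ a = W (∑ i, k i • g i)}

/-! ### Existence of the Weyl algebra

The operators `(W f ψ)(h) = exp (-(i/2) σ(f, h)) ψ(h - f)` on `ℓ²(X)` generate a Weyl algebra. -/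

section Model

variable {X : Type u} [AddCommGroup X] [Module ℝ X] (σ : LinearMap.BilinForm ℝ X)

lemma norm_weylPhase (f h : X) : ‖Complex.exp (-(Complex.I / 2) * (σ f h : ℂ))‖ = 1 := by
  rw [Complex.norm_exp]; simp

lemma memℓp_weylShift (f : X) (ψ : ℓ²(X, ℂ)) :
    Memℓp (fun h => Complex.exp (-(Complex.I / 2) * (σ f h : ℂ)) * ψ (h - f)) 2 := by
  have h1 := (memℓp_gen_iff (by norm_num)).1 (lp.memℓp ψ)
  refine (memℓp_gen_iff (by norm_num)).2 ?_
  simp only [norm_mul, norm_weylPhase, one_mul]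
  exact (Equiv.subRight f).summable_iff.2 h1

/-- The Weyl operators on `ℓ²(X)`. -/
def weylModelIsometry (f : X) : ℓ²(X, ℂ) →ₗᵢ[ℂ] ℓ²(X, ℂ) where
  toFun ψ := ⟨_, memℓp_weylShift σ f ψ⟩
  map_add' a b := lp.ext (funext fun _ => mul_add _ _ _)
  map_smul' c a := lp.ext (funext fun _ => mul_left_comm _ _ _)
  norm_map' ψ := by
    rw [lp.norm_eq_tsum_rpow (by norm_num), lp.norm_eq_tsum_rpow (by norm_num)]
    congr 1
    refine (tsum_congr fun h => ?_).trans
      ((Equiv.subRight f).tsum_eq (fun h => ‖ψ h‖ ^ (2 : ENNReal).toReal))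
    change ‖Complex.exp (-(Complex.I / 2) * (σ f h : ℂ)) * ψ (h - f)‖ ^ _ = _
    rw [norm_mul, norm_weylPhase, one_mul]
    rfl

/-- The Weyl operators on `ℓ²(X)` as bounded operators. -/
def weylModelOp (f : X) : ℓ²(X, ℂ) →L[ℂ] ℓ²(X, ℂ) :=
  (weylModelIsometry σ f).toContinuousLinearMap

lemma weylModelOp_apply (f : X) (ψ : ℓ²(X, ℂ)) (h : X) :
    weylModelOp σ f ψ h = Complex.exp (-(Complex.I / 2) * (σ f h : ℂ)) * ψ (h - f) := rfl

variable {σ}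

lemma weylModelOp_mul (hσ : σ.IsAlt) (f g : X) :
    weylModelOp σ f * weylModelOp σ g =
      Complex.exp (-(Complex.I / 2) * (σ f g : ℂ)) • weylModelOp σ (f + g) := by
  refine ContinuousLinearMap.ext fun ψ => ?_
  ext h
  have e : σ f h + σ g (h - f) = σ f g + σ (f + g) h := by
    have := hσ.neg_eq f g
    simp only [map_sub, map_add, LinearMap.add_apply]
    linarith
  have e' : (σ f h : ℂ) + σ g (h - f) = σ f g + σ (f + g) h := by exact_mod_cast e
  change weylModelOp σ f (weylModelOp σ g ψ) h = _ * weylModelOp σ (f + g) ψ h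
  rw [weylModelOp_apply, weylModelOp_apply, weylModelOp_apply, ← mul_assoc, ← mul_assoc,
    ← Complex.exp_add, ← Complex.exp_add, ← mul_add, ← mul_add, e', sub_sub]

lemma weylModelOp_zero : weylModelOp σ 0 = 1 := by
  refine ContinuousLinearMap.ext fun ψ => ?_
  ext h
  rw [weylModelOp_apply]
  simp

lemma weylModelOp_mul_neg (hσ : σ.IsAlt) (f : X) :
    weylModelOp σ f * weylModelOp σ (-f) = 1 := by
  rw [weylModelOp_mul hσ, add_neg_cancel, weylModelOp_zero, map_neg, hσ.self_eq_zero]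
  simp

lemma weylModelOp_star_mul (f : X) : star (weylModelOp σ f) * weylModelOp σ f = 1 :=
  ContinuousLinearMap.ext fun ψ => by
    refine ext_inner_left ℂ fun χ => ?_
    change inner ℂ χ (ContinuousLinearMap.adjoint (weylModelOp σ f) (weylModelOp σ f ψ)) = _
    rw [ContinuousLinearMap.adjoint_inner_right]
    exact (weylModelIsometry σ f).inner_map_map χ ψ

lemma weylModelOp_star (hσ : σ.IsAlt) (f : X) :
    star (weylModelOp σ f) = weylModelOp σ (-f) := by
  rw [← mul_one (star _), ← weylModelOp_mul_neg hσ f, ← mul_assoc, weylModelOp_star_mul, one_mul]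

/-- A Weyl algebra exists for every symplectic vector space. -/
theorem exists_isWeylAlgebra (hσ : σ.IsAlt) :
    ∃ (A : Type u) (_ : CStarAlgebra A) (W : X → A), IsWeylAlgebra σ W := by
  let S := (weylStarAlgebra (weylModelOp σ)).topologicalClosure
  have hS : ∀ f, weylModelOp σ f ∈ S := fun f =>
    StarSubalgebra.le_topologicalClosure _ (StarAlgebra.subset_adjoin _ _ ⟨f, rfl⟩)
  have hc : IsClosed (S : Set (ℓ²(X, ℂ) →L[ℂ] ℓ²(X, ℂ))) :=
    StarSubalgebra.isClosed_topologicalClosure _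
  have : Nontrivial (ℓ²(X, ℂ)) := by
    classical
    refine ⟨lp.single 2 0 1, 0, fun h => ?_⟩
    have := congrArg (fun ψ : ℓ²(X, ℂ) => ψ 0) h
    simp at this
  have hstar : ∀ f, star (⟨weylModelOp σ f, hS f⟩ : S) = ⟨weylModelOp σ (-f), hS (-f)⟩ :=
    fun f => Subtype.ext (weylModelOp_star hσ f)
  refine ⟨S, StarSubalgebra.cstarAlgebra S, fun f => ⟨weylModelOp σ f, hS f⟩, ?_, ?_, hstar, ?_, ?_⟩
  · exact inferInstanceAs (Nontrivial S)
  · intro f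
    rw [Unitary.mem_iff, hstar]
    refine ⟨Subtype.ext ?_, Subtype.ext (weylModelOp_mul_neg hσ f)⟩
    simpa using weylModelOp_mul_neg hσ (-f)
  · exact fun f g => Subtype.ext (weylModelOp_mul hσ f g)
  · refine eq_top_iff.2 fun x _ => ?_
    have himg : (weylStarAlgebra (fun f => (⟨weylModelOp σ f, hS f⟩ : S))).map S.subtype =
        weylStarAlgebra (weylModelOp σ) := by
      rw [weylStarAlgebra, StarAlgHom.map_adjoin, weylStarAlgebra, ← Set.range_comp]
      rfl
    change x ∈ closure (weylStarAlgebra (fun f => (⟨weylModelOp σ f, hS f⟩ : S)) : Set S)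
    rw [Topology.IsInducing.subtypeVal.closure_eq_preimage_closure_image]
    have hx : (x : ℓ²(X, ℂ) →L[ℂ] ℓ²(X, ℂ)) ∈
        closure (weylStarAlgebra (weylModelOp σ) : Set (ℓ²(X, ℂ) →L[ℂ] ℓ²(X, ℂ))) := x.2
    rw [← himg] at hx
    exact hx

end Model

end

/-!
The Weyl elements form a linearly independent family of unitaries, so everything reduces to Følner
sets of the abelian group `X`: multiplication by `W f` moves the span of `W f'`, `f' ∈ B`, only by
the elements of `B` that translation by `f` moves out of `B`, and for `f` a generator of a box with
side length `N` these are at most a fraction `1 / N` of the box.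

Linear independence comes from nondegeneracy, through conjugation by Weyl elements, which multiplies
`W f` by phases `exp (i σ(f, g))`; the same argument yields a bounded functional, and hence a state
`τ`, for which the `W f` are orthonormal in the GNS space. Compressing the GNS representation to the
spans of Weyl elements over Følner sets `B` gives contractive completely positive maps `φ_B`. They
fail to be multiplicative only on the columns indexed by the boundary of `B`, a negligible set for
the normalized trace. They are asymptotically isometric because `T ↦ |B|⁻¹ ∑ Tᵢⱼ W fᵢ (W fⱼ)⋆` is a
contraction which approximately inverts `φ_B`.
-/

noncomputable section

section FolnerBoxes

variable {X : Type*} [AddCommGroup X]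

lemma sum_add_single_nsmul {ι : Type*} [Fintype ι] [DecidableEq ι] (g : ι → X) (k : ι → ℕ) (i : ι)
    (m : ℕ) : ∑ l, (k + Pi.single i m : ι → ℕ) l • g l = ∑ l, k l • g l + m • g i := by
  rw [← Fintype.linearCombination_apply ℕ g k, ← Fintype.linearCombination_apply_single ℕ g i m,
    ← map_add, Fintype.linearCombination_apply]

variable [DecidableEq X]

/-- The points of `B` which the translation by `f` moves out of `B`, an inner boundary whose
relative size measures how far `B` is from being invariant under `f`. -/
def translationBoundary (f : X) (B : Finset X) : Finset X :=
  {y ∈ B | f + y ∉ B}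

lemma mem_translationBoundary {f y : X} {B : Finset X} :
    y ∈ translationBoundary f B ↔ y ∈ B ∧ f + y ∉ B := by
  simp [translationBoundary]

-- The `N` translates `∂ - j • f`, `j < N`, of the boundary `∂` are pairwise disjoint.
lemma mul_card_translationBoundary_le {f : X} {B : Finset X} {N : ℕ}
    (h : ∀ y ∈ translationBoundary f B, ∀ j < N, y - j • f ∈ B) :
    N * (translationBoundary f B).card ≤ B.card := by
  have le_of_sub_eq : ∀ y ∈ translationBoundary f B, ∀ y' ∈ translationBoundary f B,
      ∀ j, ∀ j' < N, y - j • f = y' - j' • f → j' ≤ j := by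
    intro y hy y' hy' j j' hj' heq
    by_contra! hlt
    obtain ⟨m, rfl⟩ := Nat.exists_eq_add_of_lt hlt
    have hshift : f + y = y' - m • f := by
      rw [sub_eq_iff_eq_add.1 heq]
      module
    exact (mem_translationBoundary.1 hy).2 (hshift ▸ h y' hy' m (by lia))
  calc N * (translationBoundary f B).card
      = (Finset.range N ×ˢ translationBoundary f B).card := by
        rw [Finset.card_product, Finset.card_range]
    _ ≤ B.card := by
        refine Finset.card_le_card_of_injOn (fun p => p.2 - p.1 • f) ?_ ?_
        · rintro ⟨j, y⟩ hp
          obtain ⟨hj, hy⟩ := Finset.mem_product.1 hp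
          exact h y hy j (Finset.mem_range.1 hj)
        · rintro ⟨j, y⟩ hp ⟨j', y'⟩ hp' heq
          obtain ⟨hj, hy⟩ := Finset.mem_product.1 hp
          obtain ⟨hj', hy'⟩ := Finset.mem_product.1 hp'
          obtain rfl : j = j' := le_antisymm
            (le_of_sub_eq y' hy' y hy j' j (Finset.mem_range.1 hj) heq.symm)
            (le_of_sub_eq y hy y' hy' j j' (Finset.mem_range.1 hj') heq)
          exact Prod.ext rfl (sub_left_inj.1 heq)

variable {ι : Type*} [Fintype ι] [DecidableEq ι]

/-- The box of all integer combinations `∑ i, k i • g i` with coefficients `1 ≤ k i ≤ N`. -/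
def boxFinset (g : ι → X) (N : ℕ) : Finset X :=
  (Fintype.piFinset fun _ => Finset.Icc 1 N).image fun k => ∑ i, k i • g i

lemma mem_boxFinset {g : ι → X} {N : ℕ} {x : X} :
    x ∈ boxFinset g N ↔ ∃ k : ι → ℕ, (∀ i, 1 ≤ k i ∧ k i ≤ N) ∧ x = ∑ i, k i • g i := by
  simp [boxFinset, eq_comm]

lemma boxFinset_nonempty (g : ι → X) {N : ℕ} (hN : 1 ≤ N) : (boxFinset g N).Nonempty :=
  ⟨_, mem_boxFinset.2 ⟨fun _ => 1, fun _ => ⟨le_rfl, hN⟩, rfl⟩⟩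

lemma sub_nsmul_mem_boxFinset {g : ι → X} {N : ℕ} {i : ι} {y : X}
    (hy : y ∈ translationBoundary (g i) (boxFinset g N)) {j : ℕ} (hj : j < N) :
    y - j • g i ∈ boxFinset g N := by
  obtain ⟨hy, hgy⟩ := mem_translationBoundary.1 hy
  obtain ⟨k, hk, rfl⟩ := mem_boxFinset.1 hy
  have hki : k i = N := by
    refine le_antisymm (hk i).2 (not_lt.1 fun hlt => hgy (mem_boxFinset.2 ?_))
    refine ⟨k + Pi.single i 1, fun l => ?_, by rw [sum_add_single_nsmul, one_smul, add_comm]⟩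
    obtain rfl | hl := eq_or_ne l i
    · simp only [Pi.add_apply, Pi.single_eq_same]
      lia
    · simpa only [Pi.add_apply, Pi.single_eq_of_ne hl, add_zero] using hk l
  have hsingle : Pi.single i j ≤ k := update_le_iff.2 ⟨by lia, fun _ _ => Nat.zero_le _⟩
  obtain ⟨k', rfl⟩ : ∃ k', k = k' + (Pi.single i j : ι → ℕ) :=
    ⟨_, (tsub_add_cancel_of_le hsingle).symm⟩
  refine mem_boxFinset.2 ⟨k', fun l => ?_, by rw [sum_add_single_nsmul, add_sub_cancel_right]⟩
  obtain rfl | hl := eq_or_ne l i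
  · have hkl := hk l
    simp only [Pi.add_apply, Pi.single_eq_same] at hkl hki
    lia
  · simpa only [Pi.add_apply, Pi.single_eq_of_ne hl, add_zero] using hk l

lemma card_translationBoundary_boxFinset_le (g : ι → X) {N : ℕ} (hN : 1 ≤ N) (i : ι) :
    ((translationBoundary (g i) (boxFinset g N)).card : ℝ) ≤ (boxFinset g N).card / N := by
  rw [le_div_iff₀' (by exact_mod_cast hN)]
  exact_mod_cast mul_card_translationBoundary_le fun y hy j hj => sub_nsmul_mem_boxFinset hy hj

lemma exists_folner_finset (s : Finset X) {ε : ℝ} (hε : 0 < ε) :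
    ∃ B : Finset X, B.Nonempty ∧ ∀ f ∈ s, ((translationBoundary f B).card : ℝ) ≤ ε * B.card := by
  obtain ⟨n, hn⟩ := exists_nat_one_div_lt hε
  let g : s → X := (↑)
  refine ⟨boxFinset g (n + 1), boxFinset_nonempty g n.succ_pos, fun f hf => ?_⟩
  calc ((translationBoundary f (boxFinset g (n + 1))).card : ℝ)
      ≤ (boxFinset g (n + 1)).card / (n + 1 : ℕ) :=
        card_translationBoundary_boxFinset_le g n.succ_pos ⟨f, hf⟩
    _ = 1 / ((n : ℝ) + 1) * (boxFinset g (n + 1)).card := by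
        rw [Nat.cast_succ]
        ring
    _ ≤ ε * (boxFinset g (n + 1)).card := by gcongr

end FolnerBoxes

lemma exists_net_tendsto_zero {α β : Type*} {P : β → Prop} {r : α → β → ℝ}
    (hr : ∀ a x, P x → 0 ≤ r a x)
    (h : ∀ F : Finset α, ∀ ε > 0, ∃ x, P x ∧ ∀ a ∈ F, r a x ≤ ε) :
    ∃ x : Finset α × ℕ → β,
      (∀ p, P (x p)) ∧ ∀ a, Tendsto (fun p => r a (x p)) atTop (𝓝 0) := by
  choose x hx hle using fun p : Finset α × ℕ =>
    h p.1 (1 / ((p.2 : ℝ) + 1)) Nat.one_div_pos_of_nat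
  refine ⟨x, hx, fun a => ?_⟩
  have hlim : Tendsto (fun p : Finset α × ℕ => 1 / ((p.2 : ℝ) + 1)) atTop (𝓝 0) := by
    rw [← prod_atTop_atTop_eq]
    exact tendsto_one_div_add_atTop_nhds_zero_nat.comp tendsto_snd
  refine squeeze_zero' (Eventually.of_forall fun p => hr a _ (hx p)) ?_ hlim
  filter_upwards [eventually_ge_atTop (({a}, 0) : Finset α × ℕ)] with p hp
  exact hle p a (hp.1 (Finset.mem_singleton_self a))

lemma mul_mem_of_mem_span_of_mem_span {R A : Type*} [CommSemiring R] [Semiring A] [Algebra R A]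
    {s t : Set A} {p : Submodule R A} (h : ∀ x ∈ s, ∀ y ∈ t, x * y ∈ p) {a b : A}
    (ha : a ∈ Submodule.span R s) (hb : b ∈ Submodule.span R t) : a * b ∈ p := by
  have hab := Submodule.mul_mem_mul ha hb
  rw [Submodule.span_mul_span] at hab
  exact Submodule.span_le.2 (Set.mul_subset_iff.2 h) hab

lemma exists_finset_forall_mem_span_image {R M ι : Type*} [Semiring R] [AddCommMonoid M]
    [Module R M] {w : ι → M} (F : Finset M)
    (hF : ∀ a ∈ F, a ∈ Submodule.span R (Set.range w)) :
    ∃ s : Finset ι, ∀ a ∈ F, a ∈ Submodule.span R (w '' s) := by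
  classical
  have hsupport : ∀ a ∈ F, ∃ s : Finset ι, a ∈ Submodule.span R (w '' s) := fun a ha => by
    obtain ⟨c, rfl⟩ := Finsupp.mem_span_range_iff_exists_finsupp.1 (hF a ha)
    exact ⟨c.support, Submodule.sum_mem _ fun i hi =>
      Submodule.smul_mem _ _ (Submodule.subset_span ⟨i, hi, rfl⟩)⟩
  choose! s hs using hsupport
  refine ⟨F.biUnion s, fun a ha => Submodule.span_mono (Set.image_mono ?_) (hs a ha)⟩
  exact_mod_cast Finset.subset_biUnion_of_mem s ha

lemma isAlgebraicallyAmenable_of_forall_finset {A : Type v} [CStarAlgebra A]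
    {S : StarSubalgebra ℂ A}
    (h : ∀ F : Finset A, (∀ a ∈ F, a ∈ S) → ∀ ε : ℝ, 0 < ε → ∃ V : Submodule ℂ A,
      (V ≤ S.toSubalgebra.toSubmodule ∧ V ≠ ⊥ ∧ FiniteDimensional ℂ V) ∧
      ∀ a ∈ F, (Module.finrank ℂ (mulAddSubspace a V) : ℝ) ≤ (1 + ε) * Module.finrank ℂ V) :
    IsAlgebraicallyAmenable S := by
  classical
  have finrank_pos : ∀ V : Submodule ℂ A, V ≠ ⊥ → FiniteDimensional ℂ V →
      (0 : ℝ) < Module.finrank ℂ V := fun V hV _ => by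
    exact_mod_cast Submodule.one_le_finrank_iff.2 hV
  let IsAdmissible : Submodule ℂ A → Prop := fun V =>
    V ≤ S.toSubalgebra.toSubmodule ∧ V ≠ ⊥ ∧ FiniteDimensional ℂ V
  let excess : S → Submodule ℂ A → ℝ := fun a V =>
    (Module.finrank ℂ (mulAddSubspace (a : A) V) : ℝ) / Module.finrank ℂ V - 1
  have excess_nonneg : ∀ a V, IsAdmissible V → 0 ≤ excess a V := by
    rintro a V ⟨-, hV, hfin⟩
    have : FiniteDimensional ℂ (mulAddSubspace (a : A) V) := by
      unfold mulAddSubspace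
      infer_instance
    rw [sub_nonneg, one_le_div (finrank_pos V hV hfin)]
    exact_mod_cast Submodule.finrank_mono (le_sup_right : V ≤ mulAddSubspace (a : A) V)
  have exists_excess_le : ∀ F : Finset S, ∀ ε > 0,
      ∃ V, IsAdmissible V ∧ ∀ a ∈ F, excess a V ≤ ε := by
    intro F ε hε
    obtain ⟨V, hV, hle⟩ := h (F.map (Function.Embedding.subtype _)) (by simp +contextual) ε hε
    refine ⟨V, hV, fun a ha => ?_⟩
    rw [sub_le_iff_le_add', div_le_iff₀ (finrank_pos V hV.2.1 hV.2.2)]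
    exact hle a (Finset.mem_map_of_mem _ ha)
  obtain ⟨V, hV, hlim⟩ := exists_net_tendsto_zero excess_nonneg exists_excess_le
  refine ⟨Finset S × ℕ, inferInstance, inferInstance, inferInstance, V, hV, fun a ha => ?_⟩
  simpa only [excess, sub_add_cancel, zero_add] using (hlim ⟨a, ha⟩).add_const 1

lemma norm_smul_le_norm_sum_of_exists_contraction {𝕜 E ι : Type*} [NormedField 𝕜]
    [SeminormedAddCommGroup E] [NormedSpace 𝕜 E] {w : ι → E} {i : ι}
    (hT : ∀ j ≠ i, ∃ (T : E →ₗ[𝕜] E) (μ : ι → 𝕜),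
      (∀ x, ‖T x‖ ≤ ‖x‖) ∧ (∀ k, T (w k) = μ k • w k) ∧ μ i = 1 ∧ μ j = 0)
    {s : Finset ι} (hi : i ∈ s) (c : ι → 𝕜) : ‖c i • w i‖ ≤ ‖∑ k ∈ s, c k • w k‖ := by
  classical
  obtain ⟨s, his, rfl⟩ : ∃ t, i ∉ t ∧ s = insert i t :=
    ⟨s.erase i, Finset.notMem_erase i s, (Finset.insert_erase hi).symm⟩
  clear hi
  induction s using Finset.induction_on generalizing c with
  | empty => simp
  | insert j s hj ih =>
    rw [Finset.mem_insert, not_or] at his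
    obtain ⟨T, μ, hTle, hTw, hμi, hμj⟩ := hT j (Ne.symm his.1)
    calc ‖c i • w i‖ = ‖(μ i * c i) • w i‖ := by rw [hμi, one_mul]
      _ ≤ ‖∑ k ∈ insert i s, (μ k * c k) • w k‖ := ih (fun k => μ k * c k) his.2
      _ = ‖T (∑ k ∈ insert i (insert j s), c k • w k)‖ := by
        have hji : j ∉ insert i s := by simp [hj, Ne.symm his.1]
        simp_rw [Finset.insert_comm i j, map_sum, map_smul, hTw, smul_smul, mul_comm (c _)]
        rw [Finset.sum_insert hji, hμj, zero_mul, zero_smul, zero_add]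
      _ ≤ ‖∑ k ∈ insert i (insert j s), c k • w k‖ := hTle _

lemma norm_half_smul_add_smul_conj_le {A : Type*} [CStarAlgebra A] {u : A} (hu : u ∈ unitary A)
    {ω : ℂ} (hω : ‖ω‖ = 1) (a : A) : ‖(1 / 2 : ℂ) • (a + ω • (u * a * star u))‖ ≤ ‖a‖ := by
  have hconj : ‖ω • (u * a * star u)‖ = ‖a‖ := by
    rw [norm_smul, hω, one_mul, CStarRing.norm_mul_mem_unitary _ (Unitary.star_mem hu),
      CStarRing.norm_mem_unitary_mul _ hu]
  calc ‖(1 / 2 : ℂ) • (a + ω • (u * a * star u))‖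
      ≤ ‖(1 / 2 : ℂ)‖ * (‖a‖ + ‖ω • (u * a * star u)‖) := by
        rw [norm_smul]
        gcongr
        exact norm_add_le _ _
    _ = ‖a‖ := by
        rw [hconj]
        norm_num
        ring

namespace IsWeylAlgebra

variable {X : Type u} [AddCommGroup X] [Module ℝ X] {σ : LinearMap.BilinForm ℝ X}
  {A : Type v} [CStarAlgebra A] {W : X → A}

lemma star_mul_self_eq (hW : IsWeylAlgebra σ W) (f : X) : star (W f) * W f = 1 :=
  (hW.unitary f).1

lemma self_mul_star_eq (hW : IsWeylAlgebra σ W) (f : X) : W f * star (W f) = 1 :=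
  (hW.unitary f).2

lemma norm_apply (hW : IsWeylAlgebra σ W) (f : X) : ‖W f‖ = 1 := by
  have := hW.nontrivial
  exact CStarRing.norm_of_mem_unitary (hW.unitary f)

lemma apply_zero (hW : IsWeylAlgebra σ W) : W 0 = 1 := by
  have hidem : W 0 * W 0 = W 0 := by simpa using hW.mul_eq 0 0
  rw [← hW.star_mul_self_eq 0, ← hidem, ← mul_assoc, hidem, hW.star_mul_self_eq, one_mul]

lemma conj_eq (hW : IsWeylAlgebra σ W) (hσ : σ.IsAlt) (h f : X) :
    W h * W f * star (W h) = Complex.exp (-(σ h f : ℂ) * Complex.I) • W f := by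
  have hskew : σ (h + f) (-h) = σ h f := by
    rw [map_neg, map_add, LinearMap.add_apply, hσ.self_eq_zero, zero_add, hσ.neg_eq]
  rw [hW.mul_eq, hW.star_eq, smul_mul_assoc, hW.mul_eq, smul_smul, ← Complex.exp_add, hskew,
    add_neg_cancel_comm]
  congr 2
  ring

-- The contraction averages `a` with `W h * a * star (W h)`, rotated so that `W f` is fixed, where
-- `h` is chosen with `σ h (f - g) = π`.
lemma exists_contraction (hW : IsWeylAlgebra σ W) (hσ : σ.IsAlt) (hnd : σ.Nondegenerate)
    {f g : X} (hgf : g ≠ f) :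
    ∃ (T : A →ₗ[ℂ] A) (μ : X → ℂ),
      (∀ a, ‖T a‖ ≤ ‖a‖) ∧ (∀ k, T (W k) = μ k • W k) ∧ μ f = 1 ∧ μ g = 0 := by
  obtain ⟨h₀, hh₀⟩ : ∃ h, σ h (f - g) ≠ 0 := by
    by_contra! hzero
    exact sub_ne_zero.2 hgf.symm (hnd.2 _ hzero)
  let h := (Real.pi / σ h₀ (f - g)) • h₀
  have hπ : σ h f - σ h g = Real.pi := by
    rw [← map_sub, map_smul, LinearMap.smul_apply, smul_eq_mul, div_mul_cancel₀ _ hh₀]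
  let ω : ℂ := Complex.exp (σ h f * Complex.I)
  let χ : X → ℂ := fun k => Complex.exp ((σ h f - σ h k : ℝ) * Complex.I)
  have hωχ : ∀ k, ω * Complex.exp (-(σ h k : ℂ) * Complex.I) = χ k := fun k => by
    rw [← Complex.exp_add, ← add_mul, ← sub_eq_add_neg, ← Complex.ofReal_sub]
  refine ⟨(1 / 2 : ℂ) • (LinearMap.id + ω • LinearMap.mulLeftRight ℂ (W h, star (W h))),
    fun k => (1 / 2) * (1 + χ k),
    norm_half_smul_add_smul_conj_le (hW.unitary h) (Complex.norm_exp_ofReal_mul_I _), fun k => ?_,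
    by norm_num [χ], by simp only [χ, hπ, Complex.exp_pi_mul_I, add_neg_cancel, mul_zero]⟩
  change (1 / 2 : ℂ) • (W k + ω • (W h * W k * star (W h))) = ((1 / 2) * (1 + χ k)) • W k
  rw [hW.conj_eq hσ, smul_smul, hωχ, mul_smul, add_smul, one_smul]

lemma norm_coeff_le (hW : IsWeylAlgebra σ W) (hσ : σ.IsAlt) (hnd : σ.Nondegenerate)
    {s : Finset X} (c : X → ℂ) {f : X} (hf : f ∈ s) : ‖c f‖ ≤ ‖∑ g ∈ s, c g • W g‖ := by
  simpa only [norm_smul, hW.norm_apply, mul_one] using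
    norm_smul_le_norm_sum_of_exists_contraction
      (fun _ hgf => hW.exists_contraction hσ hnd hgf) hf c

lemma linearIndependent (hW : IsWeylAlgebra σ W) (hσ : σ.IsAlt) (hnd : σ.Nondegenerate) :
    LinearIndependent ℂ W :=
  linearIndependent_iff'.2 fun s c hc f hf => by
    simpa only [hc, norm_zero, norm_le_zero_iff] using hW.norm_coeff_le hσ hnd c hf

lemma weylStarAlgebra_toSubmodule (hW : IsWeylAlgebra σ W) :
    (weylStarAlgebra W).toSubalgebra.toSubmodule = Submodule.span ℂ (Set.range W) := by
  have hstar : star (Set.range W) ⊆ Set.range W := by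
    rintro a ⟨f, hf⟩
    exact ⟨-f, by rw [← hW.star_eq, hf, star_star]⟩
  have hmul : ∀ a ∈ Set.range W, ∀ b ∈ Set.range W, a * b ∈ Submodule.span ℂ (Set.range W) := by
    rintro _ ⟨f, rfl⟩ _ ⟨g, rfl⟩
    rw [hW.mul_eq]
    exact Submodule.smul_mem _ _ (Submodule.subset_span ⟨f + g, rfl⟩)
  rw [weylStarAlgebra, StarAlgebra.adjoin_eq_span, Set.union_eq_self_of_subset_right hstar]
  refine le_antisymm (Submodule.span_le.2 fun a ha => ?_)
    (Submodule.span_mono Submonoid.subset_closure)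
  induction ha using Submonoid.closure_induction with
  | mem a ha => exact Submodule.subset_span ha
  | one => exact Submodule.subset_span ⟨0, hW.apply_zero⟩
  | mul a b _ _ ha hb => exact mul_mem_of_mem_span_of_mem_span hmul ha hb

lemma mem_weylStarAlgebra_iff (hW : IsWeylAlgebra σ W) {a : A} :
    a ∈ weylStarAlgebra W ↔ a ∈ Submodule.span ℂ (Set.range W) := by
  rw [← hW.weylStarAlgebra_toSubmodule]
  rfl

lemma dense_span (hW : IsWeylAlgebra σ W) :
    Dense (Submodule.span ℂ (Set.range W) : Set A) := by
  have hcoe : (Submodule.span ℂ (Set.range W) : Set A) = weylStarAlgebra W :=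
    Set.ext fun _ => hW.mem_weylStarAlgebra_iff.symm
  rw [hcoe, dense_iff_closure_eq, ← StarSubalgebra.topologicalClosure_coe, hW.generates]
  rfl

lemma exists_functional (hW : IsWeylAlgebra σ W) (hσ : σ.IsAlt) (hnd : σ.Nondegenerate) :
    ∃ τ : A →L[ℂ] ℂ, τ (W 0) = 1 ∧ ∀ f ≠ 0, τ (W f) = 0 := by
  have hli := hW.linearIndependent hσ hnd
  let coeff : Submodule.span ℂ (Set.range W) →ₗ[ℂ] ℂ := Finsupp.lapply 0 ∘ₗ hli.repr
  have hcoeff : ∀ x, ‖coeff x‖ ≤ 1 * ‖x‖ := fun x => by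
    have hx := hli.linearCombination_repr x
    rw [Finsupp.linearCombination_apply, Finsupp.sum] at hx
    change ‖hli.repr x 0‖ ≤ 1 * ‖(x : A)‖
    rw [one_mul, ← hx]
    by_cases h0 : (0 : X) ∈ (hli.repr x).support
    · exact hW.norm_coeff_le hσ hnd _ h0
    · rw [Finsupp.notMem_support_iff.1 h0, norm_zero]
      exact norm_nonneg _
  obtain ⟨τ, hτ, -⟩ := exists_extension_norm_eq (𝕜 := ℂ) _ (coeff.mkContinuous 1 hcoeff)
  have hval : ∀ f, τ (W f) = Finsupp.single f 1 0 := fun f => by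
    rw [← hli.repr_eq_single f ⟨W f, Submodule.subset_span ⟨f, rfl⟩⟩ rfl]
    exact hτ ⟨W f, Submodule.subset_span ⟨f, rfl⟩⟩
  exact ⟨τ, by rw [hval, Finsupp.single_eq_same],
    fun f hf => by rw [hval, Finsupp.single_eq_of_ne' hf]⟩

lemma exists_state [PartialOrder A] [StarOrderedRing A] (hW : IsWeylAlgebra σ W) (hσ : σ.IsAlt)
    (hnd : σ.Nondegenerate) :
    ∃ τ : A →ₚ[ℂ] ℂ, Orthonormal ℂ fun f => τ.toPreGNS (W f) := by
  classical
  obtain ⟨τ, hτ0, hτ⟩ := hW.exists_functional hσ hnd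
  have hortho : ∀ f g, τ (star (W f) * W g) = if f = g then 1 else 0 := fun f g => by
    split_ifs with hfg
    · rw [hfg, hW.star_mul_self_eq, ← hW.apply_zero, hτ0]
    · rw [hW.star_eq, hW.mul_eq, map_smul, hτ _ (neg_add_eq_zero.not.2 hfg), smul_zero]
  have hnonneg : ∀ a, 0 ≤ τ (star a * a) := by
    have hclosed : IsClosed {a : A | 0 ≤ τ (star a * a)} :=
      isClosed_le continuous_const (by fun_prop)
    refine fun a => hclosed.closure_subset_iff.2 (fun b hb => ?_) (hW.dense_span a)
    obtain ⟨c, rfl⟩ := Finsupp.mem_span_range_iff_exists_finsupp.1 hb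
    simp only [Set.mem_ofPred_eq, Finsupp.sum, star_sum, star_smul, Finset.sum_mul_sum,
      smul_mul_smul_comm, map_sum, map_smul, hortho, smul_eq_mul, mul_ite, mul_one, mul_zero,
      Finset.sum_ite_eq]
    exact Finset.sum_nonneg fun f hf => by
      rw [if_pos hf]
      exact star_mul_self_nonneg (c f)
  refine ⟨PositiveLinearMap.mk₀ τ.toLinearMap fun a ha => ?_, orthonormal_iff_ite.2 hortho⟩
  obtain ⟨b, rfl⟩ := CStarAlgebra.nonneg_iff_eq_star_mul_self.1 ha
  exact hnonneg b

end IsWeylAlgebra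

section WeylBoxes

variable {X : Type u} [AddCommGroup X] {A : Type v} [CStarAlgebra A]

lemma weylBoxSubspace_eq [DecidableEq X] (W : X → A) {n : ℕ} (g : Fin n → X) (N : ℕ) :
    weylBoxSubspace W g N = Submodule.span ℂ (W '' boxFinset g N) := by
  refine congrArg _ (Set.ext fun a => ?_)
  simp only [Set.mem_ofPred_eq, Set.mem_image, Finset.mem_coe, mem_boxFinset]
  aesop

lemma finiteDimensional_weylBoxSubspace (W : X → A) {n : ℕ} (g : Fin n → X) (N : ℕ) :
    FiniteDimensional ℂ (weylBoxSubspace W g N) := by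
  classical
  rw [weylBoxSubspace_eq]
  exact FiniteDimensional.span_of_finite ℂ ((boxFinset g N).finite_toSet.image W)

namespace IsWeylAlgebra

variable [Module ℝ X] {σ : LinearMap.BilinForm ℝ X} {W : X → A}

lemma mulAddSubspace_span_image_le [DecidableEq X] (hW : IsWeylAlgebra σ W)
    (s B : Finset X) {a : A} (ha : a ∈ Submodule.span ℂ (W '' s)) :
    mulAddSubspace a (Submodule.span ℂ (W '' B)) ≤
      Submodule.span ℂ
        (W '' ↑(B ∪ s.biUnion fun f => (translationBoundary f B).image (f + ·))) := by
  refine sup_le (Submodule.map_le_iff_le_comap.2 fun b hb => ?_)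
    (Submodule.span_mono (Set.image_mono (by simp)))
  rw [Submodule.mem_comap, LinearMap.mulLeft_apply]
  refine mul_mem_of_mem_span_of_mem_span ?_ ha hb
  rintro _ ⟨f, hf, rfl⟩ _ ⟨y, hy, rfl⟩
  rw [hW.mul_eq]
  refine Submodule.smul_mem _ _ (Submodule.subset_span (Set.mem_image_of_mem W ?_))
  by_cases h : f + y ∈ B
  · exact Finset.mem_union_left _ h
  · exact Finset.mem_union_right _ (Finset.mem_biUnion.2
      ⟨f, hf, Finset.mem_image_of_mem _ (mem_translationBoundary.2 ⟨hy, h⟩)⟩)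

lemma finrank_mulAddSubspace_span_image_le [DecidableEq X] (hW : IsWeylAlgebra σ W)
    (s B : Finset X) {a : A} (ha : a ∈ Submodule.span ℂ (W '' s)) :
    Module.finrank ℂ (mulAddSubspace a (Submodule.span ℂ (W '' B))) ≤
      B.card + ∑ f ∈ s, (translationBoundary f B).card := by
  classical
  let C := B ∪ s.biUnion fun f => (translationBoundary f B).image (f + ·)
  have hle : mulAddSubspace a (Submodule.span ℂ (W '' B)) ≤
      Submodule.span ℂ (C.image W : Set A) := by
    rw [Finset.coe_image]
    exact hW.mulAddSubspace_span_image_le s B ha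
  calc Module.finrank ℂ (mulAddSubspace a (Submodule.span ℂ (W '' B)))
      ≤ Module.finrank ℂ (Submodule.span ℂ (C.image W : Set A)) := Submodule.finrank_mono hle
    _ ≤ C.card := (finrank_span_finset_le_card _).trans Finset.card_image_le
    _ ≤ B.card + ∑ f ∈ s, ((translationBoundary f B).image (f + ·)).card :=
        (Finset.card_union_le _ _).trans (Nat.add_le_add_left Finset.card_biUnion_le _)
    _ ≤ B.card + ∑ f ∈ s, (translationBoundary f B).card :=
        Nat.add_le_add_left (Finset.sum_le_sum fun _ _ => Finset.card_image_le) _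

lemma weylBoxSubspace_le (hW : IsWeylAlgebra σ W) {n : ℕ} (g : Fin n → X) (N : ℕ) :
    weylBoxSubspace W g N ≤ (weylStarAlgebra W).toSubalgebra.toSubmodule := by
  classical
  rw [hW.weylStarAlgebra_toSubmodule, weylBoxSubspace_eq]
  exact Submodule.span_mono (Set.image_subset_range _ _)

lemma weylBoxSubspace_ne_bot (hW : IsWeylAlgebra σ W) {n : ℕ} (g : Fin n → X) {N : ℕ}
    (hN : 1 ≤ N) : weylBoxSubspace W g N ≠ ⊥ := by
  classical
  obtain ⟨f, hf⟩ := boxFinset_nonempty g hN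
  rw [weylBoxSubspace_eq]
  refine (Submodule.ne_bot_iff _).2 ⟨W f, Submodule.subset_span ⟨f, hf, rfl⟩, ?_⟩
  rw [← norm_ne_zero_iff, hW.norm_apply]
  exact one_ne_zero

lemma finrank_weylBoxSubspace [DecidableEq X] (hW : IsWeylAlgebra σ W) (hσ : σ.IsAlt)
    (hnd : σ.Nondegenerate) {n : ℕ} (g : Fin n → X) (N : ℕ) :
    Module.finrank ℂ (weylBoxSubspace W g N) = (boxFinset g N).card := by
  have hli : LinearIndependent ℂ fun f : boxFinset g N => W f :=
    (hW.linearIndependent hσ hnd).comp _ Subtype.val_injective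
  rw [weylBoxSubspace_eq, Set.image_eq_range, ← Fintype.card_coe]
  exact finrank_span_eq_card hli

lemma finrank_mulAddSubspace_weylBoxSubspace_le (hW : IsWeylAlgebra σ W) (hσ : σ.IsAlt)
    (hnd : σ.Nondegenerate) {n : ℕ} (g : Fin n → X) {N : ℕ} (hN : 1 ≤ N) {s : Finset X}
    (hs : ∀ f ∈ s, f ∈ Set.range g) {a : A} (ha : a ∈ Submodule.span ℂ (W '' s)) :
    (Module.finrank ℂ (mulAddSubspace a (weylBoxSubspace W g N)) : ℝ) ≤
      (1 + s.card / N) * Module.finrank ℂ (weylBoxSubspace W g N) := by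
  classical
  rw [hW.finrank_weylBoxSubspace hσ hnd, weylBoxSubspace_eq]
  calc (Module.finrank ℂ (mulAddSubspace a (Submodule.span ℂ (W '' boxFinset g N))) : ℝ)
      ≤ (boxFinset g N).card + ∑ f ∈ s, ((translationBoundary f (boxFinset g N)).card : ℝ) := by
        exact_mod_cast hW.finrank_mulAddSubspace_span_image_le s (boxFinset g N) ha
    _ ≤ (boxFinset g N).card + ∑ _f ∈ s, ((boxFinset g N).card : ℝ) / N := by
        gcongr with f hf
        obtain ⟨i, rfl⟩ := hs f hf
        exact card_translationBoundary_boxFinset_le g hN i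
    _ = (1 + s.card / N) * (boxFinset g N).card := by
        rw [Finset.sum_const, nsmul_eq_mul]
        ring

lemma exists_finrank_mulAddSubspace_le (hW : IsWeylAlgebra σ W) (hσ : σ.IsAlt)
    (hnd : σ.Nondegenerate) (F : Finset A) (hF : ∀ a ∈ F, a ∈ weylStarAlgebra W) {ε : ℝ}
    (hε : 0 < ε) :
    ∃ (n : ℕ) (g : Fin n → X) (N₀ : ℕ), ∀ N ≥ N₀, 1 ≤ N → ∀ a ∈ F,
      (Module.finrank ℂ (mulAddSubspace a (weylBoxSubspace W g N)) : ℝ) ≤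
        (1 + ε) * Module.finrank ℂ (weylBoxSubspace W g N) := by
  obtain ⟨s, hs⟩ := exists_finset_forall_mem_span_image F
    fun a ha => hW.mem_weylStarAlgebra_iff.1 (hF a ha)
  obtain ⟨N₀, hN₀⟩ := exists_nat_ge (s.card / ε)
  refine ⟨s.card, fun i => s.equivFin.symm i, N₀, fun N hN hN1 a ha => ?_⟩
  have hsmall : (s.card : ℝ) / N ≤ ε :=
    div_le_of_le_mul₀ N.cast_nonneg hε.le
      ((div_le_iff₀' hε).1 (hN₀.trans (Nat.cast_le.2 hN)))
  refine (hW.finrank_mulAddSubspace_weylBoxSubspace_le hσ hnd _ hN1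
    (fun f hf => ⟨s.equivFin ⟨f, hf⟩, by simp⟩) (hs a ha)).trans ?_
  gcongr

lemma isAlgebraicallyAmenable (hW : IsWeylAlgebra σ W) (hσ : σ.IsAlt) (hnd : σ.Nondegenerate) :
    IsAlgebraicallyAmenable (weylStarAlgebra W) := by
  refine isAlgebraicallyAmenable_of_forall_finset fun F hF ε hε => ?_
  obtain ⟨n, g, N₀, hle⟩ := hW.exists_finrank_mulAddSubspace_le hσ hnd F hF hε
  exact ⟨weylBoxSubspace W g (max N₀ 1), ⟨hW.weylBoxSubspace_le g _,
    hW.weylBoxSubspace_ne_bot g (le_max_right _ _), finiteDimensional_weylBoxSubspace W g _⟩,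
    hle _ (le_max_left _ _) (le_max_right _ _)⟩

end IsWeylAlgebra

end WeylBoxes

section Compression

open scoped MatrixOrder Matrix Matrix.Norms.L2Operator in
lemma exists_conjTranspose_mul_self_of_posSemidef {n : Type*} [Fintype n]
    {M : Matrix n n ℂ} (hM : M.PosSemidef) : ∃ C : Matrix n n ℂ, M = Cᴴ * C := by
  classical
  exact CStarAlgebra.nonneg_iff_eq_star_mul_self.1 hM.nonneg

lemma cstarMatrix_nonneg_of_posSemidef {m n : Type*} [Fintype m] [Fintype n]
    (P : CStarMatrix m m (CStarMatrix n n ℂ))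
    (hP : (Matrix.of fun p q : m × n => P p.1 q.1 p.2 q.2).PosSemidef) : 0 ≤ P := by
  obtain ⟨C, hC⟩ := exists_conjTranspose_mul_self_of_posSemidef hP
  let D : CStarMatrix m m (CStarMatrix n n ℂ) :=
    CStarMatrix.ofMatrix fun i j => CStarMatrix.ofMatrix fun x y => C (i, x) (j, y)
  suffices P = star D * D by rw [this]; exact star_mul_self_nonneg D
  ext i j x y
  have hentry := congrFun (congrFun hC (i, x)) (j, y)
  rw [Matrix.of_apply, Matrix.mul_apply, Fintype.sum_prod_type] at hentry
  rw [hentry, CStarMatrix.mul_apply]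
  exact (Matrix.sum_apply x y Finset.univ fun l => star (D l i) * D l j).symm

-- Used at `CStarMatrix n n A`, where the continuous functional calculus instances that
-- `CStarAlgebra.nonneg_iff_eq_star_mul_self` needs are not found directly.
lemma exists_eq_star_mul_self_of_nonneg {B : Type*} [NonUnitalCStarAlgebra B] [PartialOrder B]
    [StarOrderedRing B] {b : B} (hb : 0 ≤ b) : ∃ c, b = star c * c :=
  CStarAlgebra.nonneg_iff_eq_star_mul_self.1 hb

lemma norm_sum_star_smul_of_orthonormal {ι E : Type*} [Fintype ι] [SeminormedAddCommGroup E]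
    [InnerProductSpace ℂ E] {x : ι → E} (hx : Orthonormal ℂ x)
    (v : WithCStarModule ℂ (ι → ℂ)) :
    ‖∑ i, star (v i) • x i‖ = ‖v‖ := by
  rw [← sq_eq_sq₀ (norm_nonneg _) (norm_nonneg _), WithCStarModule.pi_norm_sq]
  have hsq := hx.inner_sum (fun i => star (v i)) (fun i => star (v i)) Finset.univ
  rw [inner_self_eq_norm_sq_to_K] at hsq
  simpa [WithCStarModule.inner_def, Complex.mul_conj'] using congrArg norm hsq

variable {A : Type v} [CStarAlgebra A] {ι : Type*} [Fintype ι]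

open scoped Classical in
/-- The indices `j` for which `a wⱼ` leaves the span of the family `w`. They play the role of the
boundary of a Følner set. -/
def exitIndices (w : ι → A) (a : A) : Finset ι :=
  {j | a * w j ∉ Submodule.span ℂ (Set.range w)}

lemma mem_exitIndices {w : ι → A} {a : A} {j : ι} :
    j ∈ exitIndices w a ↔ a * w j ∉ Submodule.span ℂ (Set.range w) := by
  simp [exitIndices]

lemma notMem_exitIndices {w : ι → A} {a : A} {j : ι} :
    j ∉ exitIndices w a ↔ a * w j ∈ Submodule.span ℂ (Set.range w) := by
  rw [mem_exitIndices, not_not]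

variable [PartialOrder A] [StarOrderedRing A]

lemma sum_apply_star_mul_smul_of_mem_span {τ : A →ₚ[ℂ] ℂ} {w : ι → A}
    (hw : Orthonormal ℂ fun i => τ.toPreGNS (w i)) {x : A}
    (hx : x ∈ Submodule.span ℂ (Set.range w)) : ∑ i, τ (star (w i) * x) • w i = x := by
  obtain ⟨c, rfl⟩ := (Submodule.mem_span_range_iff_exists_fun ℂ).1 hx
  refine Finset.sum_congr rfl fun i _ => congrArg (· • w i) ?_
  have hcoeff := hw.inner_right_fintype c i
  simp only [← map_smul, ← map_sum] at hcoeff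
  exact hcoeff

/-- The completely positive map `a ↦ (τ(wᵢ⋆ a wⱼ))ᵢⱼ`. When the `wᵢ` are orthonormal in the GNS
space of `τ`, this is the compression of the GNS representation to their span. -/
def compressionMap (τ : A →ₚ[ℂ] ℂ) (w : ι → A) : A →CP CStarMatrix ι ι ℂ where
  toFun a := CStarMatrix.ofMatrix fun i j => τ (star (w i) * a * w j)
  map_add' a b := CStarMatrix.ext fun i j => by
    change τ _ = τ _ + τ _
    rw [mul_add, add_mul, map_add]
  map_smul' c a := CStarMatrix.ext fun i j => by
    change τ _ = c • τ _
    rw [mul_smul_comm, smul_mul_assoc, map_smul]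
  map_cstarMatrix_nonneg' n M hM := by
    refine cstarMatrix_nonneg_of_posSemidef _ ?_
    obtain ⟨b, rfl⟩ := exists_eq_star_mul_self_of_nonneg hM
    have hgram := Matrix.posSemidef_sum (Finset.univ : Finset (Fin n)) fun l _ =>
      Matrix.posSemidef_gram ℂ fun p : Fin n × ι => τ.toPreGNS (b l p.1 * w p.2)
    refine Eq.subst (motive := fun M : Matrix (Fin n × ι) (Fin n × ι) ℂ => M.PosSemidef)
      (Eq.symm ?_) hgram
    refine Matrix.ext fun p q => ?_
    rw [Matrix.sum_apply]
    change τ (star (w p.2) * (∑ l, star (b l p.1) * b l q.1) * w q.2) = _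
    rw [Finset.mul_sum, Finset.sum_mul, map_sum]
    refine Finset.sum_congr rfl fun l _ => ?_
    rw [Matrix.gram_apply, PositiveLinearMap.preGNS_inner_def]
    simp [mul_assoc]

lemma compressionMap_apply (τ : A →ₚ[ℂ] ℂ) (w : ι → A) (a : A) (i j : ι) :
    compressionMap τ w a i j = τ (star (w i) * a * w j) := rfl

variable {τ : A →ₚ[ℂ] ℂ} {w : ι → A}

lemma inner_compressionMap (a : A) (u v : WithCStarModule ℂ (ι → ℂ)) :
    inner ℂ u (CStarMatrix.toCLM (compressionMap τ w a) v) =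
      inner ℂ (∑ i, star (v i) • τ.toPreGNS (w i))
        (τ.leftMulMapPreGNS a (∑ j, star (u j) • τ.toPreGNS (w j))) := by
  rw [map_sum, sum_inner]
  simp_rw [inner_sum]
  rw [WithCStarModule.pi_inner, Finset.sum_comm]
  refine Finset.sum_congr rfl fun j _ => ?_
  rw [WithCStarModule.inner_def, CStarMatrix.toCLM_apply_eq_sum,
    WithCStarModule.equiv_symm_pi_apply, Finset.sum_mul]
  refine Finset.sum_congr rfl fun i _ => ?_
  rw [compressionMap_apply, map_smul, inner_smul_left, inner_smul_right,
    PositiveLinearMap.preGNS_inner_def]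
  simp [mul_assoc, mul_comm (starRingEnd ℂ (u j))]

lemma norm_compressionMap_le (hw : Orthonormal ℂ fun i => τ.toPreGNS (w i)) (a : A) :
    ‖compressionMap τ w a‖ ≤ ‖a‖ := by
  refine CStarMatrix.norm_le_of_forall_inner_le (C := ‖a‖₊) fun v u => ?_
  have hleft : ‖τ.leftMulMapPreGNS a‖ ≤ ‖a‖ := LinearMap.mkContinuous_norm_le _ (norm_nonneg a) _
  rw [inner_compressionMap]
  calc _ ≤ ‖∑ i, star (v i) • τ.toPreGNS (w i)‖ *
        ‖τ.leftMulMapPreGNS a (∑ j, star (u j) • τ.toPreGNS (w j))‖ := norm_inner_le_norm _ _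
    _ ≤ ‖∑ i, star (v i) • τ.toPreGNS (w i)‖ *
        (‖a‖ * ‖∑ j, star (u j) • τ.toPreGNS (w j)‖) := by
        gcongr
        exact ContinuousLinearMap.le_of_opNorm_le _ hleft _
    _ = ↑‖a‖₊ * ‖v‖ * ‖u‖ := by
        rw [norm_sum_star_smul_of_orthonormal hw, norm_sum_star_smul_of_orthonormal hw,
          coe_nnnorm]
        ring

lemma norm_compressionMap_mul_sub_le (hw : Orthonormal ℂ fun i => τ.toPreGNS (w i)) (a b : A) :
    ‖compressionMap τ w (a * b) - compressionMap τ w a * compressionMap τ w b‖ ≤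
      2 * ‖a‖ * ‖b‖ := by
  have hmap := norm_compressionMap_le hw
  calc _ ≤ ‖compressionMap τ w (a * b)‖ + ‖compressionMap τ w a‖ * ‖compressionMap τ w b‖ :=
        (norm_sub_le _ _).trans (by gcongr; exact norm_mul_le _ _)
    _ ≤ ‖a‖ * ‖b‖ + ‖a‖ * ‖b‖ := by
        gcongr
        exacts [(hmap _).trans (norm_mul_le a b), hmap a, hmap b]
    _ = 2 * ‖a‖ * ‖b‖ := by ring

lemma compressionMap_mul_apply_of_notMem_exitIndices
    (hw : Orthonormal ℂ fun i => τ.toPreGNS (w i)) {b : A} {j : ι}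
    (hj : j ∉ exitIndices w b) (a : A) (i : ι) :
    compressionMap τ w (a * b) i j = (compressionMap τ w a * compressionMap τ w b) i j := by
  calc τ (star (w i) * (a * b) * w j)
      = τ (star (w i) * a * ∑ l, τ (star (w l) * (b * w j)) • w l) := by
        rw [sum_apply_star_mul_smul_of_mem_span hw (notMem_exitIndices.1 hj)]
        simp only [mul_assoc]
    _ = ∑ l, τ (star (w i) * a * w l) * τ (star (w l) * b * w j) := by
        rw [Finset.mul_sum, map_sum]
        refine Finset.sum_congr rfl fun l _ => ?_
        rw [mul_smul_comm, map_smul, smul_eq_mul, mul_comm, mul_assoc (star (w l))]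

end Compression

section Reconstruction

variable {A : Type v} [CStarAlgebra A] {ι : Type*} [Fintype ι]

/-- The map `T ↦ k⁻¹ ∑ᵢⱼ Tᵢⱼ wᵢ wⱼ⋆`, where `k` is the number of indices: it approximately inverts
the compression to the family `w`. -/
def reconstructionMap (w : ι → A) : CStarMatrix ι ι ℂ →ₗ[ℂ] A where
  toFun T := (Fintype.card ι : ℂ)⁻¹ • ∑ i, ∑ j, T i j • (w i * star (w j))
  map_add' S T := by
    simp [add_smul, Finset.sum_add_distrib]
  map_smul' c T := by
    simp only [CStarMatrix.smul_apply, smul_assoc, ← Finset.smul_sum, RingHom.id_apply]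
    rw [smul_comm]

lemma reconstructionMap_apply (w : ι → A) (T : CStarMatrix ι ι ℂ) :
    reconstructionMap w T =
      (Fintype.card ι : ℂ)⁻¹ • ∑ i, ∑ j, T i j • (w i * star (w j)) := rfl

lemma norm_sum_smul_mul_star_le [PartialOrder A] [StarOrderedRing A] (w : ι → A)
    (T : CStarMatrix ι ι ℂ) :
    ‖∑ i, ∑ j, T i j • (w i * star (w j))‖ ≤ ‖T‖ * ‖∑ i, w i * star (w i)‖ := by
  let T' : CStarMatrix ι ι A :=
    CStarMatrix.mapₙₐ ((StarAlgHom.ofId ℂ A : ℂ →⋆ₐ[ℂ] A) : ℂ →⋆ₙₐ[ℂ] A) T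
  let x : WithCStarModule A (ι → A) := (WithCStarModule.equiv A (ι → A)).symm w
  have hinner : ∑ i, ∑ j, T i j • (w i * star (w j)) = inner A x (CStarMatrix.toCLM T' x) := by
    rw [WithCStarModule.pi_inner, Finset.sum_comm]
    refine Finset.sum_congr rfl fun j _ => ?_
    rw [WithCStarModule.inner_def, CStarMatrix.toCLM_apply_eq_sum,
      WithCStarModule.equiv_symm_pi_apply, Finset.sum_mul]
    refine Finset.sum_congr rfl fun i _ => ?_
    change _ = w i * algebraMap ℂ A (T i j) * star (w j)
    rw [Algebra.algebraMap_eq_smul_one, mul_smul_comm, mul_one, smul_mul_assoc]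
  have hT' : ‖CStarMatrix.toCLM T'‖ ≤ ‖T‖ := by
    classical
    rw [← CStarMatrix.norm_def]
    exact NonUnitalStarAlgHom.norm_apply_le _ T
  have hx : ‖x‖ ^ 2 = ‖∑ i, w i * star (w i)‖ := by
    rw [WithCStarModule.pi_norm_sq]
    rfl
  rw [hinner]
  calc _ ≤ ‖x‖ * ‖CStarMatrix.toCLM T' x‖ := CStarModule.norm_inner_le _
    _ ≤ ‖x‖ * (‖T‖ * ‖x‖) := by
        gcongr
        exact ContinuousLinearMap.le_of_opNorm_le _ hT' _
    _ = ‖T‖ * ‖∑ i, w i * star (w i)‖ := by rw [← hx]; ring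

lemma norm_reconstructionMap_le [PartialOrder A] [StarOrderedRing A] {w : ι → A}
    (hw : ∀ i, ‖w i‖ ≤ 1) (T : CStarMatrix ι ι ℂ) : ‖reconstructionMap w T‖ ≤ ‖T‖ := by
  have hsum : ‖∑ i, w i * star (w i)‖ ≤ Fintype.card ι := by
    refine (norm_sum_le_of_le (f := fun i => w i * star (w i)) (n := fun _ => 1) _
      fun i _ => ?_).trans (by simp)
    rw [CStarRing.norm_self_mul_star]
    exact mul_le_one₀ (hw i) (norm_nonneg _) (hw i)
  rw [reconstructionMap_apply, norm_smul, norm_inv, Complex.norm_natCast]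
  refine inv_mul_le_of_le_mul₀ (Nat.cast_nonneg _) (norm_nonneg T) ?_
  rw [mul_comm _ ‖T‖]
  exact (norm_sum_smul_mul_star_le w T).trans (by gcongr)

lemma norm_reconstructionMap_compressionMap_sub_le [PartialOrder A] [StarOrderedRing A]
    [Nonempty ι] {τ : A →ₚ[ℂ] ℂ} {w : ι → A}
    (hw : Orthonormal ℂ fun i => τ.toPreGNS (w i)) (hunit : ∀ i, w i * star (w i) = 1) {a : A}
    (hexit : ∀ j ∈ exitIndices w a, ∀ i, compressionMap τ w a i j = 0) :
    ‖reconstructionMap w (compressionMap τ w a) - a‖ ≤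
      (exitIndices w a).card / Fintype.card ι * ‖a‖ := by
  let column (j : ι) : A := ∑ i, compressionMap τ w a i j • (w i * star (w j))
  have hcolumn_of_notMem : ∀ j ∉ exitIndices w a, column j = a := fun j hj => by
    calc column j = (∑ i, τ (star (w i) * (a * w j)) • w i) * star (w j) := by
          simp only [column, compressionMap_apply, Finset.sum_mul, smul_mul_assoc, mul_assoc]
      _ = a := by
          rw [sum_apply_star_mul_smul_of_mem_span hw (notMem_exitIndices.1 hj), mul_assoc,
            hunit, mul_one]
  have hcolumn_of_mem : ∀ j ∈ exitIndices w a, column j = 0 := fun j hj =>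
    Finset.sum_eq_zero fun i _ => by rw [hexit j hj, zero_smul]
  have hsum : ‖∑ j, (column j - a)‖ ≤ (exitIndices w a).card * ‖a‖ := by
    rw [← Finset.sum_subset (Finset.subset_univ (exitIndices w a))
      fun j _ hj => by rw [hcolumn_of_notMem j hj, sub_self], ← nsmul_eq_mul]
    exact (norm_sum_le_of_le _ fun j hj => by rw [hcolumn_of_mem j hj, zero_sub, norm_neg]).trans_eq
      (Finset.sum_const _)
  have hdiff : reconstructionMap w (compressionMap τ w a) - a =
      (Fintype.card ι : ℂ)⁻¹ • ∑ j, (column j - a) := by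
    rw [reconstructionMap_apply, Finset.sum_comm, Finset.sum_sub_distrib, smul_sub,
      Finset.sum_const, Finset.card_univ, ← Nat.cast_smul_eq_nsmul ℂ,
      inv_smul_smul₀ (Nat.cast_ne_zero.2 Fintype.card_ne_zero)]
  rw [hdiff, norm_smul, norm_inv, Complex.norm_natCast, div_mul_eq_mul_div, div_eq_inv_mul]
  gcongr

end Reconstruction

section TraceNorm

variable {k : ℕ}

lemma re_star_mul_self_apply (F : CStarMatrix (Fin k) (Fin k) ℂ) (j : Fin k) :
    ((star F * F) j j).re = ∑ i, ‖F i j‖ ^ 2 := by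
  rw [CStarMatrix.mul_apply, Complex.re_sum]
  refine Finset.sum_congr rfl fun i _ => ?_
  rw [CStarMatrix.star_apply, Complex.star_def, ← Complex.normSq_eq_conj_mul_self,
    Complex.ofReal_re, Complex.normSq_eq_norm_sq]

lemma sum_norm_sq_column_le (F : CStarMatrix (Fin k) (Fin k) ℂ) (j : Fin k) :
    ∑ i, ‖F i j‖ ^ 2 ≤ ‖F‖ ^ 2 := by
  rw [← re_star_mul_self_apply, sq, ← CStarRing.norm_star_mul_self]
  exact (Complex.re_le_norm _).trans CStarMatrix.norm_entry_le_norm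

lemma traceNorm₂_eq (F : CStarMatrix (Fin k) (Fin k) ℂ) :
    traceNorm₂ F = √((∑ j, ∑ i, ‖F i j‖ ^ 2) / k) := by
  rw [traceNorm₂, Complex.re_sum]
  simp_rw [re_star_mul_self_apply]

lemma traceNorm₂_le_sqrt_card_mul_norm {F : CStarMatrix (Fin k) (Fin k) ℂ} {J : Finset (Fin k)}
    (hF : ∀ j ∉ J, ∀ i, F i j = 0) : traceNorm₂ F ≤ √(J.card / k) * ‖F‖ := by
  rw [traceNorm₂_eq, ← Real.sqrt_sq (norm_nonneg F), ← Real.sqrt_mul (by positivity),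
    div_mul_eq_mul_div]
  gcongr
  calc ∑ j, ∑ i, ‖F i j‖ ^ 2 = ∑ j ∈ J, ∑ i, ‖F i j‖ ^ 2 :=
        (Finset.sum_subset (Finset.subset_univ J) fun j _ hj => by simp [hF j hj]).symm
    _ ≤ J.card • ‖F‖ ^ 2 := Finset.sum_le_card_nsmul _ _ _ fun j _ => sum_norm_sq_column_le F j
    _ = J.card * ‖F‖ ^ 2 := nsmul_eq_mul _ _

lemma traceNorm₂_le_norm (F : CStarMatrix (Fin k) (Fin k) ℂ) : traceNorm₂ F ≤ ‖F‖ := by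
  refine (traceNorm₂_le_sqrt_card_mul_norm (J := Finset.univ) (by simp)).trans
    (mul_le_of_le_one_left (norm_nonneg F) ?_)
  rw [Finset.card_univ, Fintype.card_fin, Real.sqrt_le_one]
  exact div_self_le_one _

/-- The entries of a matrix as a vector in a Euclidean space, through which `traceNorm₂` inherits
the properties of a seminorm. -/
def entryVector (k : ℕ) :
    CStarMatrix (Fin k) (Fin k) ℂ →ₗ[ℂ] EuclideanSpace ℂ (Fin k × Fin k) where
  toFun F := WithLp.toLp 2 fun p => F p.2 p.1
  map_add' _ _ := rfl
  map_smul' _ _ := rfl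

/-- `traceNorm₂` as a seminorm. -/
def traceSeminorm (k : ℕ) : Seminorm ℂ (CStarMatrix (Fin k) (Fin k) ℂ) :=
  (NNReal.sqrt k)⁻¹ • (normSeminorm ℂ (EuclideanSpace ℂ (Fin k × Fin k))).comp (entryVector k)

lemma traceSeminorm_apply (F : CStarMatrix (Fin k) (Fin k) ℂ) :
    traceSeminorm k F = traceNorm₂ F := by
  have hscaled : traceSeminorm k F = (√(k : ℝ))⁻¹ * ‖entryVector k F‖ := by
    simp [traceSeminorm, NNReal.smul_def]
  rw [hscaled, traceNorm₂_eq, EuclideanSpace.norm_eq, Fintype.sum_prod_type,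
    Real.sqrt_div (by positivity), div_eq_inv_mul]
  rfl

lemma traceNorm₂_compressionMap_mul_sub_le {A : Type v} [CStarAlgebra A] [PartialOrder A]
    [StarOrderedRing A] {τ : A →ₚ[ℂ] ℂ} {w : Fin k → A}
    (hw : Orthonormal ℂ fun i => τ.toPreGNS (w i)) (a b : A) :
    traceNorm₂ (compressionMap τ w (a * b) - compressionMap τ w a * compressionMap τ w b) ≤
      √((exitIndices w b).card / k) * (2 * ‖a‖ * ‖b‖) := by
  refine (traceNorm₂_le_sqrt_card_mul_norm fun j hj i => ?_).trans
    (mul_le_mul_of_nonneg_left (norm_compressionMap_mul_sub_le hw a b) (Real.sqrt_nonneg _))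
  rw [CStarMatrix.sub_apply, compressionMap_mul_apply_of_notMem_exitIndices hw hj, sub_self]

end TraceNorm

section Density

lemma tendsto_seminorm_zero_of_dense_span {𝕜 E ι : Type*} [NormedField 𝕜]
    [SeminormedAddCommGroup E] [NormedSpace 𝕜 E] {l : Filter ι} {p : ι → Seminorm 𝕜 E} {C : ℝ}
    (hC : ∀ i a, p i a ≤ C * ‖a‖) {S : Set E} (hS : Dense (Submodule.span 𝕜 S : Set E))
    (hp : ∀ a ∈ S, Tendsto (fun i => p i a) l (𝓝 0)) (a : E) :
    Tendsto (fun i => p i a) l (𝓝 0) := by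
  have hspan : ∀ b ∈ Submodule.span 𝕜 S, Tendsto (fun i => p i b) l (𝓝 0) := by
    intro b hb
    induction hb using Submodule.span_induction with
    | mem x hx => exact hp x hx
    | zero => simpa only [map_zero] using tendsto_const_nhds
    | add x y _ _ hx hy =>
      refine squeeze_zero (fun i => apply_nonneg _ _) (fun i => map_add_le_add (p i) x y) ?_
      simpa only [add_zero] using hx.add hy
    | smul c x _ hx =>
      simp_rw [map_smul_eq_mul]
      simpa only [mul_zero] using hx.const_mul ‖c‖
  rw [Metric.tendsto_nhds]
  intro ε hε
  obtain ⟨b, hab, hb⟩ := Metric.dense_iff.1 hS a (ε / 2 / (|C| + 1)) (by positivity)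
  rw [Metric.mem_ball, dist_comm, dist_eq_norm, lt_div_iff₀ (by positivity)] at hab
  filter_upwards [(hspan b hb).eventually_lt_const (half_pos hε)] with i hi
  rw [Real.dist_0_eq_abs, abs_of_nonneg (apply_nonneg _ _)]
  calc p i a = p i (a - b + b) := by rw [sub_add_cancel]
    _ ≤ p i (a - b) + p i b := map_add_le_add (p i) _ _
    _ ≤ ‖a - b‖ * (|C| + 1) + p i b := by
        gcongr
        refine (hC i _).trans ?_
        rw [mul_comm]
        gcongr
        exact (le_abs_self C).trans (le_add_of_nonneg_right zero_le_one)
    _ < ε / 2 + ε / 2 := add_lt_add hab hi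
    _ = ε := add_halves ε

lemma tendsto_norm_of_tendsto_norm_leftInverse_sub {ι E : Type*} [SeminormedAddCommGroup E]
    {F : ι → Type*} [∀ i, SeminormedAddCommGroup (F i)] {l : Filter ι} {φ : ∀ i, E → F i}
    {R : ∀ i, F i → E} (hφ : ∀ i a, ‖φ i a‖ ≤ ‖a‖) (hR : ∀ i T, ‖R i T‖ ≤ ‖T‖) {a : E}
    (h : Tendsto (fun i => ‖R i (φ i a) - a‖) l (𝓝 0)) :
    Tendsto (fun i => ‖φ i a‖) l (𝓝 ‖a‖) := by
  have hlower : Tendsto (fun i => ‖a‖ - ‖R i (φ i a) - a‖) l (𝓝 ‖a‖) := by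
    simpa only [sub_zero] using h.const_sub ‖a‖
  refine tendsto_of_tendsto_of_tendsto_of_le_of_le hlower tendsto_const_nhds (fun i => ?_)
    fun i => hφ i a
  calc ‖a‖ - ‖R i (φ i a) - a‖ ≤ ‖R i (φ i a)‖ := by
        rw [norm_sub_rev, sub_le_comm]
        exact norm_sub_norm_le _ _
    _ ≤ ‖φ i a‖ := hR i _

/-- The defect of multiplicativity `b ↦ φ(ab) - φ(a)φ(b)` of `φ`, linear in the second factor. -/
def multiplicativityDefect {R B C : Type*} [CommSemiring R] [NonUnitalNonAssocRing B]
    [Module R B] [SMulCommClass R B B] [NonUnitalNonAssocRing C] [Module R C]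
    [SMulCommClass R C C] (φ : B →ₗ[R] C) (b : B) : B →ₗ[R] C :=
  φ ∘ₗ LinearMap.mulLeft R b - LinearMap.mulLeft R (φ b) ∘ₗ φ

lemma tendsto_traceNorm₂_of_dense_span {E ι : Type*} [SeminormedAddCommGroup E] [NormedSpace ℂ E]
    {l : Filter ι} {k : ι → ℕ} {f : ∀ i, E →ₗ[ℂ] CStarMatrix (Fin (k i)) (Fin (k i)) ℂ} {C : ℝ}
    (hC : ∀ i a, ‖f i a‖ ≤ C * ‖a‖) {S : Set E} (hS : Dense (Submodule.span ℂ S : Set E))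
    (h : ∀ a ∈ S, Tendsto (fun i => traceNorm₂ (f i a)) l (𝓝 0)) (a : E) :
    Tendsto (fun i => traceNorm₂ (f i a)) l (𝓝 0) := by
  simp only [← traceSeminorm_apply] at h ⊢
  refine tendsto_seminorm_zero_of_dense_span (p := fun i => (traceSeminorm (k i)).comp (f i))
    (C := C) (fun i b => ?_) hS h a
  rw [Seminorm.comp_apply, traceSeminorm_apply]
  exact (traceNorm₂_le_norm _).trans (hC i b)

lemma tendsto_norm_sub_of_dense_span {𝕜 E ι : Type*} [NormedField 𝕜]
    [SeminormedAddCommGroup E] [NormedSpace 𝕜 E] {l : Filter ι} {f : ι → E →ₗ[𝕜] E}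
    (hf : ∀ i a, ‖f i a‖ ≤ ‖a‖) {S : Set E} (hS : Dense (Submodule.span 𝕜 S : Set E))
    (h : ∀ a ∈ S, Tendsto (fun i => ‖f i a - a‖) l (𝓝 0)) (a : E) :
    Tendsto (fun i => ‖f i a - a‖) l (𝓝 0) := by
  let p (i : ι) : Seminorm 𝕜 E := (normSeminorm 𝕜 E).comp (f i - LinearMap.id)
  have hp : ∀ i a, ‖f i a - a‖ = p i a := fun _ _ => rfl
  simp only [hp] at h ⊢
  refine tendsto_seminorm_zero_of_dense_span (C := 2) (fun i b => ?_) hS h a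
  rw [two_mul]
  exact (norm_sub_le _ _).trans (add_le_add_left (hf i b) ‖b‖)

lemma norm_le_one_of_mul_star_eq_one {A : Type*} [CStarAlgebra A] {a : A} (ha : a * star a = 1) :
    ‖a‖ ≤ 1 := by
  nontriviality A
  have hsq := CStarRing.norm_self_mul_star (x := a)
  rw [ha, CStarRing.norm_one] at hsq
  nlinarith [norm_nonneg a]

lemma isFolnerCStarAlgebra_of_dense_span {A : Type v} [CStarAlgebra A] [PartialOrder A]
    [StarOrderedRing A] {ι : Type v} [Preorder ι] [IsDirectedOrder ι] [Nonempty ι] {k : ι → ℕ}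
    (hk : ∀ p, 0 < k p) {τ : A →ₚ[ℂ] ℂ} {w : ∀ p, Fin (k p) → A}
    (hw : ∀ p, Orthonormal ℂ fun i => τ.toPreGNS (w p i))
    (hunit : ∀ p i, w p i * star (w p i) = 1) {S : Set A}
    (hS : Dense (Submodule.span ℂ S : Set A))
    (hexit : ∀ p, ∀ a ∈ S, ∀ j ∈ exitIndices (w p) a, ∀ i, compressionMap τ (w p) a i j = 0)
    (hlim : ∀ a ∈ S, Tendsto (fun p => ((exitIndices (w p) a).card : ℝ) / k p) atTop (𝓝 0)) :
    IsFolnerCStarAlgebra A := by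
  have hcontr : ∀ p a, ‖compressionMap τ (w p) a‖ ≤ ‖a‖ := fun p => norm_compressionMap_le (hw p)
  have hrec : ∀ p T, ‖reconstructionMap (w p) T‖ ≤ ‖T‖ := fun p =>
    norm_reconstructionMap_le fun i => norm_le_one_of_mul_star_eq_one (hunit p i)
  refine ⟨ι, inferInstance, inferInstance, inferInstance, k, fun p => compressionMap τ (w p), hk,
    hcontr, fun a => ?_, fun a => ?_⟩
  · refine tendsto_traceNorm₂_of_dense_span
      (f := fun p => multiplicativityDefect (compressionMap τ (w p)).toLinearMap a)
      (fun p b => norm_compressionMap_mul_sub_le (hw p) a b) hS fun b hb => ?_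
    refine squeeze_zero (fun p => Real.sqrt_nonneg _)
      (fun p => traceNorm₂_compressionMap_mul_sub_le (hw p) a b) ?_
    simpa using (hlim b hb).sqrt.mul_const (2 * ‖a‖ * ‖b‖)
  · refine tendsto_norm_of_tendsto_norm_leftInverse_sub hcontr hrec
      (tendsto_norm_sub_of_dense_span
        (f := fun p => reconstructionMap (w p) ∘ₗ (compressionMap τ (w p)).toLinearMap)
        (fun p b => (hrec p _).trans (hcontr p b)) hS (fun b hb => ?_) a)
    refine squeeze_zero (fun p => norm_nonneg _) (fun p => ?_)
      (by simpa using (hlim b hb).mul_const ‖b‖)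
    have : Nonempty (Fin (k p)) := ⟨⟨0, hk p⟩⟩
    have hbound :=
      norm_reconstructionMap_compressionMap_sub_le (hw p) (hunit p) (hexit p b hb)
    rwa [Fintype.card_fin] at hbound

end Density

section WeylFolner

variable {X : Type u} {A : Type v}

/-- The Weyl elements `W f`, `f ∈ B`, in the order of an enumeration of `B`. -/
def weylFamily (W : X → A) (B : Finset X) (i : Fin B.card) : A := W (B.equivFin.symm i)

lemma range_weylFamily (W : X → A) (B : Finset X) : Set.range (weylFamily W B) = W '' B := by
  have hcomp : weylFamily W B = (W ∘ Subtype.val) ∘ B.equivFin.symm := rfl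
  rw [hcomp, EquivLike.range_comp, Set.range_comp, Subtype.range_coe_subtype]
  rfl

namespace IsWeylAlgebra

variable [AddCommGroup X] [Module ℝ X] {σ : LinearMap.BilinForm ℝ X} [CStarAlgebra A] {W : X → A}

lemma add_notMem_of_mem_exitIndices (hW : IsWeylAlgebra σ W) {f : X} {B : Finset X}
    {j : Fin B.card} (hj : j ∈ exitIndices (weylFamily W B) (W f)) :
    f + B.equivFin.symm j ∉ B := by
  contrapose! hj
  rw [notMem_exitIndices, range_weylFamily, weylFamily, hW.mul_eq]
  exact Submodule.smul_mem _ _ (Submodule.subset_span (Set.mem_image_of_mem W hj))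

lemma card_exitIndices_weylFamily_le [DecidableEq X] (hW : IsWeylAlgebra σ W) (f : X)
    (B : Finset X) :
    (exitIndices (weylFamily W B) (W f)).card ≤ (translationBoundary f B).card :=
  Finset.card_le_card_of_injOn (fun j => (B.equivFin.symm j : X))
    (fun j hj => mem_translationBoundary.2
      ⟨(B.equivFin.symm j).2, hW.add_notMem_of_mem_exitIndices hj⟩)
    (Subtype.val_injective.comp B.equivFin.symm.injective).injOn

lemma exists_finset_card_exitIndices_le (hW : IsWeylAlgebra σ W) (F : Finset (Set.range W)) {ε : ℝ}
    (hε : 0 < ε) :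
    ∃ B : Finset X, B.Nonempty ∧ ∀ a ∈ F,
      ((exitIndices (weylFamily W B) a).card : ℝ) / B.card ≤ ε := by
  classical
  choose f hf using fun a : Set.range W => a.2
  obtain ⟨B, hB, hboundary⟩ := exists_folner_finset (F.image f) hε
  refine ⟨B, hB, fun a ha => div_le_of_le_mul₀ (Nat.cast_nonneg _) hε.le ?_⟩
  rw [← hf a]
  exact (Nat.cast_le.2 (hW.card_exitIndices_weylFamily_le (f a) B)).trans
    (hboundary _ (Finset.mem_image_of_mem f ha))

variable [PartialOrder A] [StarOrderedRing A]

lemma compressionMap_weylFamily_apply_eq_zero (hW : IsWeylAlgebra σ W) {τ : A →ₚ[ℂ] ℂ}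
    (hτ : Orthonormal ℂ fun f => τ.toPreGNS (W f)) {f : X} {B : Finset X} {j : Fin B.card}
    (hj : j ∈ exitIndices (weylFamily W B) (W f)) (i : Fin B.card) :
    compressionMap τ (weylFamily W B) (W f) i j = 0 := by
  have hne : (B.equivFin.symm i : X) ≠ f + B.equivFin.symm j := fun h =>
    hW.add_notMem_of_mem_exitIndices hj (h ▸ (B.equivFin.symm i).2)
  have horth : τ (star (W (B.equivFin.symm i)) * W (f + B.equivFin.symm j)) = 0 := hτ.2 hne
  rw [compressionMap_apply, mul_assoc, weylFamily, weylFamily, hW.mul_eq, mul_smul_comm, map_smul,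
    horth, smul_zero]

lemma isFolnerCStarAlgebra (hW : IsWeylAlgebra σ W) (hσ : σ.IsAlt) (hnd : σ.Nondegenerate) :
    IsFolnerCStarAlgebra A := by
  classical
  obtain ⟨τ, hτ⟩ := hW.exists_state hσ hnd
  obtain ⟨B, hB, hlim⟩ := exists_net_tendsto_zero (fun (a : Set.range W) (B : Finset X) _ =>
    div_nonneg (Nat.cast_nonneg (exitIndices (weylFamily W B) a).card) B.card.cast_nonneg)
    (fun F _ hε => hW.exists_finset_card_exitIndices_le F hε)
  refine isFolnerCStarAlgebra_of_dense_span (fun p => (hB p).card_pos)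
    (fun p => hτ.comp _ (Subtype.val_injective.comp (B p).equivFin.symm.injective))
    (fun p i => hW.self_mul_star_eq _) hW.dense_span ?_ fun a ha => hlim ⟨a, ha⟩
  rintro p _ ⟨f, rfl⟩ j hj i
  exact hW.compressionMap_weylFamily_apply_eq_zero hτ hj i

end IsWeylAlgebra

end WeylFolner

end

theorem mainTheorem1 {X : Type u} [AddCommGroup X] [Module ℝ X]
    (σ : LinearMap.BilinForm ℝ X) (hσ : σ.IsAlt) (hnd : σ.Nondegenerate)
    {A : Type v} [CStarAlgebra A] [PartialOrder A] [StarOrderedRing A]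
    (W : X → A) (hW : IsWeylAlgebra σ W) :
    IsAlgebraicallyAmenable (weylStarAlgebra W) ∧
    (∀ (n : ℕ) (g : Fin n → X) (N : ℕ), 1 ≤ N →
      weylBoxSubspace W g N ≤ (weylStarAlgebra W).toSubalgebra.toSubmodule ∧
      weylBoxSubspace W g N ≠ ⊥ ∧
      FiniteDimensional ℂ (weylBoxSubspace W g N) ∧
      ∀ i, (Module.finrank ℂ (mulAddSubspace (W (g i)) (weylBoxSubspace W g N)) : ℝ) ≤
        (1 + 1 / (N : ℝ)) * Module.finrank ℂ (weylBoxSubspace W g N)) ∧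
    (∀ F : Finset A, (∀ a ∈ F, a ∈ weylStarAlgebra W) → ∀ ε : ℝ, 0 < ε →
      ∃ (n : ℕ) (g : Fin n → X) (N₀ : ℕ), ∀ N ≥ N₀, 1 ≤ N → ∀ a ∈ F,
        (Module.finrank ℂ (mulAddSubspace a (weylBoxSubspace W g N)) : ℝ) ≤
          (1 + ε) * Module.finrank ℂ (weylBoxSubspace W g N)) ∧
    IsFolnerCStarAlgebra A := by
  refine ⟨hW.isAlgebraicallyAmenable hσ hnd, fun n g N hN => ⟨hW.weylBoxSubspace_le g N,
    hW.weylBoxSubspace_ne_bot g hN, finiteDimensional_weylBoxSubspace W g N, fun i => ?_⟩,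
    fun F hF ε hε => hW.exists_finrank_mulAddSubspace_le hσ hnd F hF hε,
    hW.isFolnerCStarAlgebra hσ hnd⟩
  have hgenerator : W (g i) ∈ Submodule.span ℂ (W '' ({g i} : Finset X)) :=
    Submodule.subset_span (Set.mem_image_of_mem W (Finset.mem_singleton_self _))
  simpa using hW.finrank_mulAddSubspace_weylBoxSubspace_le hσ hnd g hN (by simp) hgenerator
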